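/- Let $A\in\mathbb R^{n\times n}$ be symmetric positive semidefinite, $b\in\mathbb R^n$, $\tau\ge 0$, and let $F(x)=\tfrac12 x^TAx-b^Tx+\tau\|x\|_1$ for $x\in\mathbb R^n$. Assume that the problem $F^*=\min_{x\in\mathbb R^n}F(x)$ has at least one optimal solution. For $\delta\ge 0$ put $S(\delta)=\{x\in\mathbb R^n: F(x)-F^*\le\delta\}$. For $x\in\mathbb R^n$ let $v(x)$ be the minimum-norm subgradient of $F$ at $x$, i.e. the Euclidean projection of the zero vector onto the subdifferential $\partial F(x)$, and let $F^*_x=\min\{F(y): y\in\mathbb R^n,\ y_i=0 \text{ whenever } x_i=0\}$. Then for every $\delta\ge 0$ there exists $\hat\eta>0$ (depending on $\delta$, and on the data $A,b,\tau$) such that for every $x\in S(\delta)$ the minimum $F^*_x$ is attained and $$F(x)-F^*_x\le\hat\eta\,\|[v(x)]_J\|^2,$$ where $J=\{i: x_i\neq 0\}$, $[v(x)]_J$ is the subvector of $v(x)$ with components indexed by $J$, and $\|\cdot\|$ is the Euclidean norm (with $\|[v(x)]_J\|=0$ if $J=\emptyset$). -/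

import Mathlib

noncomputable section

namespace L1QP

/-- The smooth part `f(x) = ½ xᵀAx - bᵀx`. -/
def quad {n : ℕ} (A : Matrix (Fin n) (Fin n) ℝ) (b x : EuclideanSpace ℝ (Fin n)) : ℝ :=
  1 / 2 * (x.ofLp ⬝ᵥ A.mulVec x.ofLp) - b.ofLp ⬝ᵥ x.ofLp

/-- The objective `F(x) = ½ xᵀAx - bᵀx + τ ‖x‖₁`. -/
def objective {n : ℕ} (A : Matrix (Fin n) (Fin n) ℝ) (b : EuclideanSpace ℝ (Fin n)) (τ : ℝ)
    (x : EuclideanSpace ℝ (Fin n)) : ℝ :=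
  quad A b x + τ * ∑ i, |x i|

/-- The optimal value `F^*` of `F` over the whole space. -/
def optValue {n : ℕ} (F : EuclideanSpace ℝ (Fin n) → ℝ) : ℝ :=
  sInf (Set.range F)

/-- The level set `S(δ) = {x : F(x) - F^* ≤ δ}`. -/
def levelSet {n : ℕ} (F : EuclideanSpace ℝ (Fin n) → ℝ) (δ : ℝ) :
    Set (EuclideanSpace ℝ (Fin n)) :=
  {x | F x - optValue F ≤ δ}

/-- The subspace `H(x)` of the vectors that vanish wherever `x` does. -/
def zeroSubspace {n : ℕ} (x : EuclideanSpace ℝ (Fin n)) : Set (EuclideanSpace ℝ (Fin n)) :=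
  {y | ∀ i, x i = 0 → y i = 0}

/-- The optimal value `F^*_x` of `F` over `H(x)`. -/
def subspaceOptValue {n : ℕ} (F : EuclideanSpace ℝ (Fin n) → ℝ)
    (x : EuclideanSpace ℝ (Fin n)) : ℝ :=
  sInf (F '' zeroSubspace x)

/-- The convex subdifferential of `F` at `x`. -/
def subdifferential {n : ℕ} (F : EuclideanSpace ℝ (Fin n) → ℝ) (x : EuclideanSpace ℝ (Fin n)) :
    Set (EuclideanSpace ℝ (Fin n)) :=
  {g | ∀ y, F x + inner ℝ g (y - x) ≤ F y}

/-- `v` is a projection of the zero vector onto the subdifferential of `F` at `x`. -/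
def IsMinNormSubgradient {n : ℕ} (F : EuclideanSpace ℝ (Fin n) → ℝ)
    (x v : EuclideanSpace ℝ (Fin n)) : Prop :=
  v ∈ subdifferential F x ∧ ∀ g ∈ subdifferential F x, ‖v‖ ≤ ‖g‖

open Classical in
/-- The minimum-norm subgradient of `F` at `x` (zero if there is none; for the objective above it
always exists and is given by `minNormSubgradient_objective_apply`). -/
def minNormSubgradient {n : ℕ} (F : EuclideanSpace ℝ (Fin n) → ℝ)
    (x : EuclideanSpace ℝ (Fin n)) : EuclideanSpace ℝ (Fin n) :=
  if h : ∃ v, IsMinNormSubgradient F x v then h.choose else 0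

/-- The subvector `[v]_J` with `J = {i : x i ≠ 0}`, with its Euclidean norm. -/
def restrictSupport {n : ℕ} (x v : EuclideanSpace ℝ (Fin n)) :
    EuclideanSpace ℝ {i : Fin n // x i ≠ 0} :=
  WithLp.toLp 2 fun i => v i.1

/-- The gradient `Ax - b` of the smooth part. -/
def gradQuad {n : ℕ} (A : Matrix (Fin n) (Fin n) ℝ) (b x : EuclideanSpace ℝ (Fin n)) :
    EuclideanSpace ℝ (Fin n) :=
  WithLp.toLp 2 fun i => A.mulVec x.ofLp i - b i

/-- The coordinate formula for the minimum-norm subgradient of the objective. -/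
def explicitSubgradient {n : ℕ} (A : Matrix (Fin n) (Fin n) ℝ) (b : EuclideanSpace ℝ (Fin n))
    (τ : ℝ) (x : EuclideanSpace ℝ (Fin n)) : EuclideanSpace ℝ (Fin n) :=
  WithLp.toLp 2 fun i =>
    if x i ≠ 0 then gradQuad A b x i + τ * Real.sign (x i)
    else min (gradQuad A b x i + τ) (max 0 (gradQuad A b x i - τ))

theorem objective_add {n : ℕ} {A : Matrix (Fin n) (Fin n) ℝ} (hA : A.PosSemidef)
    (b : EuclideanSpace ℝ (Fin n)) (τ : ℝ) (x d : EuclideanSpace ℝ (Fin n)) :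
    objective A b τ (x + d) = objective A b τ x + ∑ i, gradQuad A b x i * d i
      + 1 / 2 * (d.ofLp ⬝ᵥ A.mulVec d.ofLp) + τ * ∑ i, (|x i + d i| - |x i|) := by
  have hsym : x.ofLp ⬝ᵥ A.mulVec d.ofLp = d.ofLp ⬝ᵥ A.mulVec x.ofLp := by
    have hT : A.transpose = A := by
      have := hA.1
      rwa [Matrix.IsHermitian, Matrix.conjTranspose_eq_transpose_of_trivial] at this
    rw [Matrix.dotProduct_mulVec, ← Matrix.mulVec_transpose, hT, dotProduct_comm]
  have hg : ∑ i, gradQuad A b x i * d i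
      = d.ofLp ⬝ᵥ A.mulVec x.ofLp - b.ofLp ⬝ᵥ d.ofLp := by
    simp only [gradQuad, dotProduct, ← Finset.sum_sub_distrib]
    exact Finset.sum_congr rfl fun i _ => by ring
  rw [hg]
  simp only [objective, quad, WithLp.ofLp_add, Matrix.mulVec_add, dotProduct_add, add_dotProduct,
    Pi.add_apply, Finset.sum_sub_distrib, hsym]
  ring

/-- A one-sided first-order condition. -/
theorem le_of_forall_small {p q c : ℝ} {ε : ℝ} (hε : 0 < ε)
    (h : ∀ t, 0 < t → t < ε → t * p ≤ t * q + t ^ 2 * c) : p ≤ q := by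
  by_contra! hlt
  have hc : 0 < |c| + 1 := by positivity
  set t := min (ε / 2) ((p - q) / (2 * (|c| + 1))) with ht
  have ht0 : 0 < t := lt_min (by linarith) (div_pos (by linarith) (by linarith))
  have h1 := h t ht0 (lt_of_le_of_lt (min_le_left _ _) (by linarith))
  have h2 : t * (2 * (|c| + 1)) ≤ p - q := by
    rw [← le_div_iff₀ (by linarith)]; exact min_le_right _ _
  have h3 : p ≤ q + t * c := by
    have : t * p ≤ t * (q + t * c) := by nlinarith
    exact le_of_mul_le_mul_left this ht0
  have h4 : t * c ≤ t * |c| := mul_le_mul_of_nonneg_left (le_abs_self c) ht0.le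
  nlinarith

/-- Directional form of the subgradient inequality along a coordinate. -/
theorem subgradient_coord {n : ℕ} {A : Matrix (Fin n) (Fin n) ℝ} (hA : A.PosSemidef)
    {b : EuclideanSpace ℝ (Fin n)} {τ : ℝ} {x g : EuclideanSpace ℝ (Fin n)}
    (hg : g ∈ subdifferential (objective A b τ) x) (i : Fin n) (t : ℝ) :
    t * g i ≤ t * gradQuad A b x i + t ^ 2 * (A i i / 2) + τ * (|x i + t| - |x i|) := by
  have h := hg (x + EuclideanSpace.single i t)
  rw [objective_add hA] at h
  have e1 : inner ℝ g (x + EuclideanSpace.single i t - x) = t * g i := by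
    rw [add_sub_cancel_left, EuclideanSpace.inner_single_right]
    simp
  have e2 : ∑ j, gradQuad A b x j * (EuclideanSpace.single i t : EuclideanSpace ℝ (Fin n)) j
      = t * gradQuad A b x i := by
    rw [Finset.sum_eq_single i]
    · simp [mul_comm]
    · intro j _ hj; simp [hj]
    · simp
  have e3 : ∑ j, (|x j + (EuclideanSpace.single i t : EuclideanSpace ℝ (Fin n)) j| - |x j|)
      = |x i + t| - |x i| := by
    rw [Finset.sum_eq_single i]
    · simp
    · intro j _ hj; simp [hj]
    · simp
  have e4 : (EuclideanSpace.single i t : EuclideanSpace ℝ (Fin n)).ofLp ⬝ᵥ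
      A.mulVec (EuclideanSpace.single i t : EuclideanSpace ℝ (Fin n)).ofLp = t ^ 2 * A i i := by
    simp [Matrix.mulVec_single]
    ring
  rw [e1, e2, e3, e4] at h
  linarith

theorem explicit_mem {n : ℕ} {A : Matrix (Fin n) (Fin n) ℝ} (hA : A.PosSemidef)
    (b : EuclideanSpace ℝ (Fin n)) {τ : ℝ} (hτ : 0 ≤ τ) (x : EuclideanSpace ℝ (Fin n)) :
    explicitSubgradient A b τ x ∈ subdifferential (objective A b τ) x := by
  intro y
  obtain ⟨d, rfl⟩ : ∃ d, y = x + d := ⟨y - x, by abel⟩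
  rw [objective_add hA, add_sub_cancel_left]
  have hq : 0 ≤ d.ofLp ⬝ᵥ A.mulVec d.ofLp := by
    simpa using hA.dotProduct_mulVec_nonneg d.ofLp
  have key : ∀ i, explicitSubgradient A b τ x i * d i
      ≤ gradQuad A b x i * d i + τ * (|x i + d i| - |x i|) := by
    intro i
    simp only [explicitSubgradient]
    generalize gradQuad A b x i = g
    generalize x i = a
    generalize d i = e
    rcases lt_trichotomy a 0 with h | h | h
    · rw [if_pos h.ne, Real.sign_of_neg h, abs_of_neg h]
      have := mul_le_mul_of_nonneg_left (neg_abs_le (a + e)) hτ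
      nlinarith [neg_abs_le (a + e)]
    · subst h
      simp only [ne_eq, not_true_eq_false, if_false, zero_add, abs_zero, sub_zero]
      have h1 : min (g + τ) (max 0 (g - τ)) ≤ g + τ := min_le_left _ _
      have h2 : g - τ ≤ min (g + τ) (max 0 (g - τ)) :=
        le_min (by linarith) (le_max_right _ _)
      have h3 : |min (g + τ) (max 0 (g - τ)) - g| ≤ τ := abs_le.2 ⟨by linarith, by linarith⟩
      have h4 := mul_le_mul_of_nonneg_right h3 (abs_nonneg e)
      rw [← abs_mul] at h4
      have h5 := le_abs_self ((min (g + τ) (max 0 (g - τ)) - g) * e)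
      linarith
    · rw [if_pos h.ne', Real.sign_of_pos h, abs_of_pos h]
      have := mul_le_mul_of_nonneg_left (le_abs_self (a + e)) hτ
      nlinarith
  have hs := Finset.sum_le_sum fun i (_ : i ∈ Finset.univ) => key i
  rw [Finset.sum_add_distrib, ← Finset.mul_sum] at hs
  have hi : inner ℝ (explicitSubgradient A b τ x) d = ∑ i, explicitSubgradient A b τ x i * d i := by
    rw [PiLp.inner_apply]
    exact Finset.sum_congr rfl fun i _ => by simp [mul_comm]
  rw [hi]
  linarith

theorem explicit_sq_le {n : ℕ} {A : Matrix (Fin n) (Fin n) ℝ} (hA : A.PosSemidef)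
    {b : EuclideanSpace ℝ (Fin n)} {τ : ℝ} {x g : EuclideanSpace ℝ (Fin n)}
    (hg : g ∈ subdifferential (objective A b τ) x) (i : Fin n) :
    explicitSubgradient A b τ x i * explicitSubgradient A b τ x i
      ≤ explicitSubgradient A b τ x i * g i := by
  have hc := subgradient_coord hA hg i
  simp only [explicitSubgradient]
  generalize gradQuad A b x i = p at *
  generalize x i = a at *
  generalize g i = e at *
  rcases lt_trichotomy a 0 with h | h | h
  · rw [if_pos h.ne, Real.sign_of_neg h]
    have h1 : e ≤ p - τ := by
      refine le_of_forall_small (c := A i i / 2) (neg_pos.2 h) fun t ht0 ht => ?_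
      have := hc t
      rw [abs_of_neg h, abs_of_neg (by linarith : a + t < 0)] at this
      linarith
    have h2 : -e ≤ -(p - τ) := by
      refine le_of_forall_small (c := A i i / 2) one_pos fun t ht0 ht => ?_
      have := hc (-t)
      rw [abs_of_neg h, abs_of_neg (by linarith : a + -t < 0)] at this
      linarith
    have h3 : e = p + τ * -1 := by linarith
    rw [h3]
  · subst h
    simp only [ne_eq, not_true_eq_false, if_false]
    have h1 : e ≤ p + τ := by
      refine le_of_forall_small (c := A i i / 2) one_pos fun t ht0 ht => ?_
      have := hc t
      rw [zero_add, abs_of_pos ht0, abs_zero] at this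
      linarith
    have h2 : -e ≤ -(p - τ) := by
      refine le_of_forall_small (c := A i i / 2) one_pos fun t ht0 ht => ?_
      have := hc (-t)
      rw [zero_add, abs_neg, abs_of_pos ht0, abs_zero] at this
      linarith
    rcases le_total 0 (p - τ) with h3 | h3
    · rw [max_eq_right h3, min_eq_right (by linarith)]
      nlinarith
    · rw [max_eq_left h3]
      rcases le_total 0 (p + τ) with h4 | h4
      · rw [min_eq_right h4]; simp
      · rw [min_eq_left h4]; nlinarith
  · rw [if_pos h.ne', Real.sign_of_pos h]
    have h1 : e ≤ p + τ := by
      refine le_of_forall_small (c := A i i / 2) one_pos fun t ht0 ht => ?_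
      have := hc t
      rw [abs_of_pos h, abs_of_pos (by linarith : 0 < a + t)] at this
      linarith
    have h2 : -e ≤ -(p + τ) := by
      refine le_of_forall_small (c := A i i / 2) h fun t ht0 ht => ?_
      have := hc (-t)
      rw [abs_of_pos h, abs_of_pos (by linarith : 0 < a + -t)] at this
      linarith
    have h3 : e = p + τ * 1 := by linarith
    rw [h3]

theorem explicit_norm_sq_le {n : ℕ} {A : Matrix (Fin n) (Fin n) ℝ} (hA : A.PosSemidef)
    {b : EuclideanSpace ℝ (Fin n)} {τ : ℝ} {x g : EuclideanSpace ℝ (Fin n)}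
    (hg : g ∈ subdifferential (objective A b τ) x) :
    ‖explicitSubgradient A b τ x‖ ^ 2 ≤ inner ℝ (explicitSubgradient A b τ x) g := by
  rw [← real_inner_self_eq_norm_sq, PiLp.inner_apply, PiLp.inner_apply]
  refine Finset.sum_le_sum fun i _ => ?_
  have := explicit_sq_le hA hg i
  simpa [mul_comm, pow_two] using this

/-- The minimum-norm subgradient of the objective exists, is unique, and has the usual coordinate
formula. -/
theorem isMinNormSubgradient_objective_iff {n : ℕ} {A : Matrix (Fin n) (Fin n) ℝ}
    (hA : A.PosSemidef) (b : EuclideanSpace ℝ (Fin n)) {τ : ℝ} (hτ : 0 ≤ τ)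
    (x v : EuclideanSpace ℝ (Fin n)) :
    IsMinNormSubgradient (objective A b τ) x v ↔ v = explicitSubgradient A b τ x := by
  constructor
  · rintro ⟨hv, hmin⟩
    have h1 := explicit_norm_sq_le hA hv
    have h2 := hmin _ (explicit_mem hA b hτ x)
    have h3 : ‖v - explicitSubgradient A b τ x‖ ^ 2 ≤ 0 := by
      rw [norm_sub_sq_real, real_inner_comm]
      nlinarith [norm_nonneg v]
    have h4 : ‖v - explicitSubgradient A b τ x‖ = 0 := by
      nlinarith [norm_nonneg (v - explicitSubgradient A b τ x)]
    exact sub_eq_zero.1 (norm_eq_zero.1 h4)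
  · rintro rfl
    refine ⟨explicit_mem hA b hτ x, fun g hg => ?_⟩
    have h1 := explicit_norm_sq_le hA hg
    have h2 := real_inner_le_norm (explicitSubgradient A b τ x) g
    by_contra! h
    nlinarith [norm_nonneg g]

theorem minNormSubgradient_objective {n : ℕ} {A : Matrix (Fin n) (Fin n) ℝ}
    (hA : A.PosSemidef) (b : EuclideanSpace ℝ (Fin n)) {τ : ℝ} (hτ : 0 ≤ τ)
    (x : EuclideanSpace ℝ (Fin n)) :
    minNormSubgradient (objective A b τ) x = explicitSubgradient A b τ x := by
  have h : ∃ v, IsMinNormSubgradient (objective A b τ) x v :=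
    ⟨_, (isMinNormSubgradient_objective_iff hA b hτ x _).2 rfl⟩
  rw [minNormSubgradient, dif_pos h]
  exact (isMinNormSubgradient_objective_iff hA b hτ x _).1 h.choose_spec

theorem minNormSubgradient_objective_apply {n : ℕ} {A : Matrix (Fin n) (Fin n) ℝ}
    (hA : A.PosSemidef) (b : EuclideanSpace ℝ (Fin n)) {τ : ℝ} (hτ : 0 ≤ τ)
    (x : EuclideanSpace ℝ (Fin n)) (i : Fin n) :
    minNormSubgradient (objective A b τ) x i =
      if x i ≠ 0 then gradQuad A b x i + τ * Real.sign (x i)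
      else min (gradQuad A b x i + τ) (max 0 (gradQuad A b x i - τ)) := by
  rw [minNormSubgradient_objective hA b hτ]
  rfl

end L1QP

end

namespace L1QP

/-! Fix the sign pattern `s` of `x`. On `H(x)` replace `τ‖y‖₁` by the linear function `τ ∑ sᵢ yᵢ`.
This turns `F` into a convex quadratic `q_s` with `q_s ≤ F` on `H(x)` and equality at `x`
(`quad_signMatrix`), and the gradient of `q_s` at `x` is `[v(x)]_J` padded by zeros
(`norm_restrictSupport_sq`). If `z` minimizes `F` over `H(x)`, then `F(x) - F(z) ≤ q_s(x) - q_s(z)`,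
so a bound for quadratics suffices. That bound is `exists_le_norm_gradQuad_sq`. A quadratic with a
stationary point satisfies a quadratic growth estimate. One without has gradient norm bounded away
from zero, so the a priori bound `δ` on the decrease is enough. Only finitely many sign patterns
occur, hence the constant is uniform in `x`. The minimizer `z` exists although `F` need not be
coercive: minimizing points of least norm cannot escape to infinity, since a recession direction
along which `F` is constant could be subtracted to shorten them. -/

theorem quad_eq_objective_zero {n : ℕ} (A : Matrix (Fin n) (Fin n) ℝ)
    (b x : EuclideanSpace ℝ (Fin n)) : quad A b x = objective A b 0 x := by
  simp [objective]

/-! ### Attainment of the minimum over `H(x)` -/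

theorem continuous_objective {n : ℕ} (A : Matrix (Fin n) (Fin n) ℝ)
    (b : EuclideanSpace ℝ (Fin n)) (τ : ℝ) : Continuous (objective A b τ) := by
  unfold objective quad dotProduct Matrix.mulVec dotProduct
  fun_prop

theorem isClosed_zeroSubspace {n : ℕ} (x : EuclideanSpace ℝ (Fin n)) :
    IsClosed (zeroSubspace x) := by
  have : zeroSubspace x = ⋂ i, ⋂ (_ : x i = 0), {y | y i = 0} := by
    ext y; simp [zeroSubspace]
  rw [this]
  exact isClosed_iInter fun i => isClosed_iInter fun _ =>
    isClosed_eq (by fun_prop) continuous_const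

/-- The objective along a ray through the origin. -/
theorem objective_smul {n : ℕ} (A : Matrix (Fin n) (Fin n) ℝ)
    (b : EuclideanSpace ℝ (Fin n)) (τ : ℝ) {t : ℝ} (ht : 0 ≤ t)
    (u : EuclideanSpace ℝ (Fin n)) :
    objective A b τ (t • u) = t ^ 2 * (1 / 2 * (u.ofLp ⬝ᵥ A.mulVec u.ofLp))
      + t * (τ * ∑ i, |u i| - b.ofLp ⬝ᵥ u.ofLp) := by
  simp only [objective, quad, WithLp.ofLp_smul, Matrix.mulVec_smul, dotProduct_smul,
    smul_dotProduct, smul_eq_mul, Pi.smul_apply, abs_mul, abs_of_nonneg ht, ← Finset.mul_sum]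
  ring

/-- Subtracting a multiple of a recession direction along which the objective is constant. -/
theorem objective_sub_smul {n : ℕ} {A : Matrix (Fin n) (Fin n) ℝ} (hA : A.PosSemidef)
    {b : EuclideanSpace ℝ (Fin n)} {τ : ℝ} {d : EuclideanSpace ℝ (Fin n)}
    (hAd : A.mulVec d.ofLp = 0) (hd : τ * ∑ i, |d i| = b.ofLp ⬝ᵥ d.ofLp)
    {t : ℝ} (z : EuclideanSpace ℝ (Fin n))
    (hz : ∀ i, |z i - t * d i| = |z i| - t * |d i|) :
    objective A b τ (z - t • d) = objective A b τ z := by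
  have hT : A.transpose = A := by
    have := hA.1
    rwa [Matrix.IsHermitian, Matrix.conjTranspose_eq_transpose_of_trivial] at this
  have hdz : d.ofLp ⬝ᵥ A.mulVec z.ofLp = 0 := by
    rw [Matrix.dotProduct_mulVec, ← Matrix.mulVec_transpose, hT, hAd, zero_dotProduct]
  have hs : ∑ i, |z i - t * d i| = ∑ i, |z i| - t * ∑ i, |d i| := by
    rw [Finset.mul_sum, ← Finset.sum_sub_distrib]
    exact Finset.sum_congr rfl fun i _ => hz i
  simp only [objective, quad, WithLp.ofLp_sub, WithLp.ofLp_smul, Matrix.mulVec_sub,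
    Matrix.mulVec_smul, hAd, smul_zero, sub_zero, dotProduct_sub, sub_dotProduct,
    dotProduct_smul, smul_dotProduct, hdz, smul_eq_mul, Pi.sub_apply, Pi.smul_apply, hs]
  linear_combination (-t) * hd

/-- Every point of `H(x)` can be replaced by one in a fixed ball without increasing the objective,
provided the objective is bounded below. -/
theorem exists_bounded_objective_le {n : ℕ} {A : Matrix (Fin n) (Fin n) ℝ} (hA : A.PosSemidef)
    {b : EuclideanSpace ℝ (Fin n)} {τ : ℝ} {m : ℝ} (hm : ∀ y, m ≤ objective A b τ y)
    (x : EuclideanSpace ℝ (Fin n)) :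
    ∃ R : ℝ, 0 ≤ R ∧ ∀ y ∈ zeroSubspace x, ∃ z ∈ zeroSubspace x, ‖z‖ ≤ R ∧
      objective A b τ z ≤ objective A b τ y := by
  by_contra! hcon
  have hcont := continuous_objective A b τ
  have h0 : (0 : EuclideanSpace ℝ (Fin n)) ∈ zeroSubspace x := fun i _ => rfl
  have hF0 : objective A b τ 0 = 0 := by simp [objective, quad]
  -- Each `z` has least norm among the points of `H(x)` that do at least as well. Its value is
  -- negative because the origin, with value `0`, lies in every ball.
  have step : ∀ k : ℕ, ∃ z ∈ zeroSubspace x, (k : ℝ) < ‖z‖ ∧ objective A b τ z < 0 ∧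
      ∀ w ∈ zeroSubspace x, objective A b τ w ≤ objective A b τ z → ‖z‖ ≤ ‖w‖ := by
    intro k
    obtain ⟨y, hy, hyk⟩ := hcon k k.cast_nonneg
    have hclosed : IsClosed (zeroSubspace x ∩ {w | objective A b τ w ≤ objective A b τ y}) :=
      (isClosed_zeroSubspace x).inter (isClosed_le hcont continuous_const)
    obtain ⟨z, ⟨hz, hzy⟩, hmin⟩ := hclosed.exists_infDist_eq_dist ⟨y, hy, le_refl (objective A b τ y)⟩ 0
    refine ⟨z, hz, ?_, lt_of_le_of_lt hzy ?_, fun w hw hwz => ?_⟩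
    · by_contra! hk
      exact absurd hzy (not_le.2 (hyk z hz hk))
    · have := hyk 0 h0 (by simp)
      rwa [hF0] at this
    · have := Metric.infDist_le_dist_of_mem (x := (0 : EuclideanSpace ℝ (Fin n)))
        (show w ∈ zeroSubspace x ∩ {w | objective A b τ w ≤ objective A b τ y} from
          ⟨hw, hwz.trans hzy⟩)
      rw [hmin] at this
      simpa using this
  choose z hzH hzk hzneg hzmin using step
  have hpos : ∀ k, 0 < ‖z k‖ := fun k => lt_of_le_of_lt k.cast_nonneg (hzk k)
  set u : ℕ → EuclideanSpace ℝ (Fin n) := fun k => ‖z k‖⁻¹ • z k with hu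
  have hzu : ∀ k, z k = ‖z k‖ • u k := fun k => by
    simp only [hu, smul_smul, mul_inv_cancel₀ (hpos k).ne', one_smul]
  have hu1 : ∀ k, u k ∈ Metric.sphere (0 : EuclideanSpace ℝ (Fin n)) 1 := fun k => by
    simp [hu, norm_smul, (hpos k).ne']
  have huH : ∀ k, u k ∈ zeroSubspace x := fun k i hi => by simp [hu, hzH k i hi]
  obtain ⟨d, hd1, φ, hφ, hlim⟩ := (isCompact_sphere _ _).tendsto_subseq hu1
  have hd1' : ‖d‖ = 1 := by simpa using hd1
  have hdH : d ∈ zeroSubspace x :=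
    (isClosed_zeroSubspace x).mem_of_tendsto hlim (Filter.Eventually.of_forall fun k => huH _)
  have hQc : Continuous fun v : EuclideanSpace ℝ (Fin n) =>
      1 / 2 * (v.ofLp ⬝ᵥ A.mulVec v.ofLp) := by
    unfold dotProduct Matrix.mulVec dotProduct
    fun_prop
  have hgc : Continuous fun v : EuclideanSpace ℝ (Fin n) =>
      τ * ∑ i, |v i| - b.ofLp ⬝ᵥ v.ofLp := by
    unfold dotProduct
    fun_prop
  have hQ : ∀ v : EuclideanSpace ℝ (Fin n), 0 ≤ v.ofLp ⬝ᵥ A.mulVec v.ofLp := fun v => by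
    simpa using hA.dotProduct_mulVec_nonneg v.ofLp
  -- This is the inequality `F(z k) < 0` along the ray through `u k`, divided by `‖z k‖`.
  have hray : ∀ k, ‖z k‖ * (1 / 2 * ((u k).ofLp ⬝ᵥ A.mulVec (u k).ofLp))
      + (τ * ∑ i, |u k i| - b.ofLp ⬝ᵥ (u k).ofLp) < 0 := fun k => by
    have h := hzneg k
    rw [hzu k, objective_smul _ _ _ (norm_nonneg _)] at h
    by_contra! hc
    nlinarith [mul_nonneg (hpos k).le hc]
  have hglim := (hgc.tendsto d).comp hlim
  have hQlim := (hQc.tendsto d).comp hlim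
  have hg_le : τ * ∑ i, |d i| - b.ofLp ⬝ᵥ d.ofLp ≤ 0 := by
    refine le_of_tendsto hglim (Filter.Eventually.of_forall fun k => ?_)
    have h1 := hray (φ k)
    have h2 := mul_nonneg (hpos (φ k)).le (hQ (u (φ k)))
    simp only [Function.comp_apply]
    linarith
  have hznorm : Filter.Tendsto (fun k => ‖z (φ k)‖) Filter.atTop Filter.atTop :=
    (Filter.tendsto_atTop_mono (fun k => (hzk k).le) tendsto_natCast_atTop_atTop).comp
      hφ.tendsto_atTop
  -- Divide `hray` once more by `‖z (φ k)‖`, which tends to infinity: the linear part disappears in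
  -- the limit.
  have hQd : d.ofLp ⬝ᵥ A.mulVec d.ofLp = 0 := by
    refine le_antisymm ?_ (hQ d)
    have hlim2 := hQlim.add (hglim.mul hznorm.inv_tendsto_atTop)
    have : 1 / 2 * (d.ofLp ⬝ᵥ A.mulVec d.ofLp)
        + (τ * ∑ i, |d i| - b.ofLp ⬝ᵥ d.ofLp) * 0 ≤ 0 := by
      refine le_of_tendsto hlim2 (Filter.Eventually.of_forall fun k => ?_)
      have h1 := hray (φ k)
      have h2 := hpos (φ k)
      simp only [Function.comp_apply, Pi.inv_apply]
      rw [← div_eq_mul_inv, ← sub_neg_eq_add, sub_nonpos, ← neg_div, le_div_iff₀ h2]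
      linarith
    linarith
  have hAd : A.mulVec d.ofLp = 0 := by
    rw [← hA.dotProduct_mulVec_zero_iff]
    simpa using hQd
  -- A negative slope `g` along `d` would give the value `-(|m| + 1) < m` at parameter `(|m| + 1) /
  -- (-g)`.
  have hg : τ * ∑ i, |d i| = b.ofLp ⬝ᵥ d.ofLp := by
    refine le_antisymm (by linarith) ?_
    by_contra! hlt
    set g := τ * ∑ i, |d i| - b.ofLp ⬝ᵥ d.ofLp with hgdef
    have hgneg : g < 0 := by linarith
    have ht : 0 ≤ (|m| + 1) / (-g) := by
      have : 0 < -g := by linarith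
      positivity
    have h := hm (((|m| + 1) / (-g)) • d)
    rw [objective_smul _ _ _ ht, hQd, ← hgdef] at h
    have : (|m| + 1) / (-g) * g = -(|m| + 1) := by
      field_simp [hgneg.ne]
    rw [this] at h
    linarith [neg_abs_le m]
  -- Half of `d` is subtracted: the norm then tends to `1/2`, and eventually each `u (φ k) i` with
  -- `d i ≠ 0` has the sign of `d i` and exceeds `|d i| / 2` in size, so the absolute values
  -- subtract exactly.
  have hev1 : ∀ᶠ k in Filter.atTop, ‖u (φ k) - (1 / 2 : ℝ) • d‖ < 1 := by
    have hl : Filter.Tendsto (fun k => ‖u (φ k) - (1 / 2 : ℝ) • d‖) Filter.atTop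
        (nhds ‖d - (1 / 2 : ℝ) • d‖) := (hlim.sub_const _).norm
    refine hl.eventually_lt_const ?_
    have : d - (1 / 2 : ℝ) • d = (1 / 2 : ℝ) • d := by module
    rw [this, norm_smul, hd1']
    norm_num
  have hev2 : ∀ᶠ k in Filter.atTop, ∀ i,
      |u (φ k) i - 1 / 2 * d i| = |u (φ k) i| - 1 / 2 * |d i| := by
    rw [Filter.eventually_all]
    intro i
    have hl : Filter.Tendsto (fun k => u (φ k) i) Filter.atTop (nhds (d i)) :=
      ((by fun_prop : Continuous fun v : EuclideanSpace ℝ (Fin n) => v i).tendsto d).comp hlim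
    rcases lt_trichotomy (d i) 0 with h | h | h
    · filter_upwards [hl.eventually_lt_const (by linarith : d i < 1 / 2 * d i)] with k hk
      rw [abs_of_neg h, abs_of_neg (by linarith), abs_of_neg (by linarith)]
      ring
    · simp [h]
    · filter_upwards [hl.eventually_const_lt (by linarith : 1 / 2 * d i < d i)] with k hk
      rw [abs_of_pos h, abs_of_pos (by linarith), abs_of_pos (by linarith)]
  obtain ⟨k, hk1, hk2⟩ := (hev1.and hev2).exists
  set r := ‖z (φ k)‖ with hr
  have hrpos : 0 < r := hpos _
  have hobj := objective_sub_smul hA hAd hg (t := r * (1 / 2)) (z (φ k)) fun i => by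
    rw [hzu (φ k), ← hr]
    simp only [PiLp.smul_apply, smul_eq_mul]
    rw [mul_assoc, ← mul_sub, abs_mul, abs_mul, abs_of_pos hrpos, hk2 i]
    ring
  -- The shifted point has the same value and lies in `H(x)`, but is strictly shorter than `z (φ
  -- k)`.
  have hle := hzmin (φ k) (z (φ k) - (r * (1 / 2)) • d)
    (fun i hi => by simp [hzH (φ k) i hi, hdH i hi]) hobj.le
  have heq : z (φ k) - (r * (1 / 2)) • d = r • (u (φ k) - (1 / 2 : ℝ) • d) := by
    rw [smul_sub, hr, ← hzu, smul_smul]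
  rw [heq, norm_smul, Real.norm_of_nonneg hrpos.le, ← hr] at hle
  nlinarith

/-- The objective attains its minimum over `H(x)` as soon as it is bounded below. -/
theorem exists_isMinOn_zeroSubspace {n : ℕ} {A : Matrix (Fin n) (Fin n) ℝ} (hA : A.PosSemidef)
    {b : EuclideanSpace ℝ (Fin n)} {τ : ℝ} {m : ℝ} (hm : ∀ y, m ≤ objective A b τ y)
    (x : EuclideanSpace ℝ (Fin n)) :
    ∃ z ∈ zeroSubspace x, ∀ y ∈ zeroSubspace x, objective A b τ z ≤ objective A b τ y := by
  obtain ⟨R, hR, h⟩ := exists_bounded_objective_le hA hm x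
  have hK : IsCompact (Metric.closedBall 0 R ∩ zeroSubspace x) :=
    (isCompact_closedBall _ _).inter_right (isClosed_zeroSubspace x)
  obtain ⟨z, hz, hmin⟩ := hK.exists_isMinOn ⟨0, by simpa using hR, fun i _ => rfl⟩
    (continuous_objective A b τ).continuousOn
  refine ⟨z, hz.2, fun y hy => ?_⟩
  obtain ⟨w, hw, hwR, hwy⟩ := h y hy
  exact (hmin ⟨by simpa using hwR, hw⟩).trans hwy

/-! ### Error bounds for convex quadratics -/

/-- A positive semidefinite form is bounded by the squared norm of its gradient. -/
theorem exists_dotProduct_mulVec_le {n : ℕ} {M : Matrix (Fin n) (Fin n) ℝ} (hM : M.PosSemidef) :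
    ∃ C : ℝ, 0 < C ∧ ∀ p : EuclideanSpace ℝ (Fin n),
      p.ofLp ⬝ᵥ M.mulVec p.ofLp ≤ C * ‖WithLp.toLp 2 (M.mulVec p.ofLp)‖ ^ 2 := by
  have hT : M.transpose = M := by
    have := hM.1
    rwa [Matrix.IsHermitian, Matrix.conjTranspose_eq_transpose_of_trivial] at this
  set T : EuclideanSpace ℝ (Fin n) →ₗ[ℝ] EuclideanSpace ℝ (Fin n) := M.toEuclideanLin with hTdef
  have hTapp : ∀ p, T p = WithLp.toLp 2 (M.mulVec p.ofLp) := fun p => rfl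
  -- A linear section of `T` over its range selects a preimage of `T p` of norm at most `‖L‖ * ‖T
  -- p‖`. By symmetry the form does not change when `p` is replaced by it.
  obtain ⟨N, hN⟩ := T.rangeRestrict.exists_rightInverse_of_surjective T.range_rangeRestrict
  set L := LinearMap.toContinuousLinearMap N with hL
  refine ⟨‖L‖ + 1, by positivity, fun p => ?_⟩
  set r : LinearMap.range T := T.rangeRestrict p with hr
  have hNr : T (N r) = T p := congrArg Subtype.val (LinearMap.congr_fun hN r)
  have hNr' : M.mulVec (N r).ofLp = M.mulVec p.ofLp := by
    simpa [hTapp] using congrArg WithLp.ofLp hNr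
  have h1 : p.ofLp ⬝ᵥ M.mulVec p.ofLp = inner ℝ (T p) (N r) := by
    rw [← hNr', Matrix.dotProduct_mulVec, ← Matrix.mulVec_transpose, hT, hTapp,
      PiLp.inner_apply]
    exact Finset.sum_congr rfl fun i _ => by simp [mul_comm]
  rw [h1, ← hTapp]
  have h2 : ‖N r‖ ≤ ‖L‖ * ‖T p‖ := L.le_opNorm r
  have h3 := real_inner_le_norm (T p) (N r)
  nlinarith [norm_nonneg (T p), mul_le_mul_of_nonneg_left h2 (norm_nonneg (T p))]

/-- Any decrease of a convex quadratic that is bounded by `δ` is bounded by a multiple of the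
squared norm of the gradient, even if the quadratic is unbounded below. -/
theorem exists_le_norm_gradQuad_sq {n : ℕ} {M : Matrix (Fin n) (Fin n) ℝ} (hM : M.PosSemidef)
    (c : EuclideanSpace ℝ (Fin n)) {δ : ℝ} (hδ : 0 ≤ δ) :
    ∃ η : ℝ, 0 < η ∧ ∀ x y : EuclideanSpace ℝ (Fin n), ∀ Δ ≤ δ, Δ ≤ quad M c x - quad M c y →
      Δ ≤ η * ‖gradQuad M c x‖ ^ 2 := by
  have hgrad : ∀ x, gradQuad M c x = M.toEuclideanLin x - c := fun x => rfl
  -- The quadratic has a stationary point exactly when `c` lies in the range of `M`.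
  by_cases hc : c ∈ LinearMap.range M.toEuclideanLin
  · obtain ⟨w, hw⟩ := hc
    obtain ⟨C, hC, hbound⟩ := exists_dotProduct_mulVec_le hM
    refine ⟨C, hC, fun x y Δ _ hΔ => hΔ.trans ?_⟩
    have hgx : ∀ x, gradQuad M c x = WithLp.toLp 2 (M.mulVec (x - w).ofLp) := fun x => by
      rw [hgrad, ← hw, ← map_sub]; rfl
    have hexp : ∀ v, quad M c v = quad M c w + 1 / 2 * ((v - w).ofLp ⬝ᵥ M.mulVec (v - w).ofLp) := by
      intro v
      have h := objective_add hM c 0 w (v - w)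
      simp only [← quad_eq_objective_zero, add_sub_cancel, hgx, sub_self] at h
      simpa using h
    have hq : ∀ v : EuclideanSpace ℝ (Fin n), 0 ≤ v.ofLp ⬝ᵥ M.mulVec v.ofLp := fun v => by
      simpa using hM.dotProduct_mulVec_nonneg v.ofLp
    rw [hgx, hexp x, hexp y]
    linarith [hbound (x - w), hq (y - w), hq (x - w)]
  · have hcl : IsClosed (LinearMap.range M.toEuclideanLin : Set (EuclideanSpace ℝ (Fin n))) :=
      Submodule.closed_of_finiteDimensional _
    have hne : (LinearMap.range M.toEuclideanLin : Set (EuclideanSpace ℝ (Fin n))).Nonempty :=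
      ⟨0, Submodule.zero_mem _⟩
    have hpos := (hcl.notMem_iff_infDist_pos hne).1 hc
    set e := Metric.infDist c (LinearMap.range M.toEuclideanLin : Set (EuclideanSpace ℝ (Fin n)))
    -- Here every gradient has norm at least `e`, so `Δ ≤ δ` alone suffices; the `+ 1` keeps the
    -- constant positive when `δ = 0`.
    refine ⟨(δ + 1) / e ^ 2, by positivity, fun x y Δ hΔ _ => ?_⟩
    have h : e ≤ ‖gradQuad M c x‖ := by
      rw [hgrad, ← dist_eq_norm, dist_comm]
      exact Metric.infDist_le_dist_of_mem ⟨x, rfl⟩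
    rw [div_mul_eq_mul_div, le_div_iff₀ (by positivity)]
    have h2 : e ^ 2 ≤ ‖gradQuad M c x‖ ^ 2 := by gcongr
    have h3 : 0 < e ^ 2 := by positivity
    nlinarith

/-! ### Quadratic models attached to sign patterns -/

/-- The compression of `A` to the coordinates where the sign pattern `s` does not vanish. -/
def signMatrix {n : ℕ} (A : Matrix (Fin n) (Fin n) ℝ) (s : Fin n → SignType) :
    Matrix (Fin n) (Fin n) ℝ :=
  Matrix.diagonal (fun i => if s i = 0 then 0 else 1) * A *
    Matrix.diagonal (fun i => if s i = 0 then 0 else 1)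

/-- The linear term of the objective on the orthant with sign pattern `s`. -/
def signVector {n : ℕ} (b : EuclideanSpace ℝ (Fin n)) (τ : ℝ) (s : Fin n → SignType) :
    EuclideanSpace ℝ (Fin n) :=
  WithLp.toLp 2 fun i => if s i = 0 then 0 else b i - τ * (s i : ℝ)

theorem posSemidef_signMatrix {n : ℕ} {A : Matrix (Fin n) (Fin n) ℝ} (hA : A.PosSemidef)
    (s : Fin n → SignType) : (signMatrix A s).PosSemidef := by
  have h := hA.conjTranspose_mul_mul_same
    (Matrix.diagonal fun i => if s i = 0 then (0 : ℝ) else 1)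
  rwa [Matrix.diagonal_conjTranspose, star_trivial] at h

theorem signMatrix_mulVec {n : ℕ} (A : Matrix (Fin n) (Fin n) ℝ) {s : Fin n → SignType}
    {y : Fin n → ℝ} (hy : ∀ i, s i = 0 → y i = 0) (i : Fin n) :
    (signMatrix A s).mulVec y i = if s i = 0 then 0 else A.mulVec y i := by
  have h : (Matrix.diagonal fun i => if s i = 0 then (0 : ℝ) else 1).mulVec y = y := by
    ext j
    rw [Matrix.mulVec_diagonal]
    split_ifs with hj
    · simp [hy j hj]
    · simp
  rw [signMatrix, ← Matrix.mulVec_mulVec, h, ← Matrix.mulVec_mulVec, Matrix.mulVec_diagonal]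
  split_ifs <;> simp

/-- The masks act trivially on vectors supported where `s` is nonzero, so only the linearized `ℓ¹`
term remains. -/
theorem quad_signMatrix {n : ℕ} (A : Matrix (Fin n) (Fin n) ℝ) (b : EuclideanSpace ℝ (Fin n))
    (τ : ℝ) {s : Fin n → SignType} {y : EuclideanSpace ℝ (Fin n)} (hy : ∀ i, s i = 0 → y i = 0) :
    quad (signMatrix A s) (signVector b τ s) y = quad A b y + τ * ∑ i, (s i : ℝ) * y i := by
  have h1 : y.ofLp ⬝ᵥ (signMatrix A s).mulVec y.ofLp = y.ofLp ⬝ᵥ A.mulVec y.ofLp := by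
    refine Finset.sum_congr rfl fun i _ => ?_
    rw [signMatrix_mulVec A hy]
    split_ifs with hi
    · simp [hy i hi]
    · rfl
  have h2 : (signVector b τ s).ofLp ⬝ᵥ y.ofLp
      = b.ofLp ⬝ᵥ y.ofLp - τ * ∑ i, (s i : ℝ) * y i := by
    simp only [dotProduct, Finset.mul_sum, ← Finset.sum_sub_distrib]
    refine Finset.sum_congr rfl fun i _ => ?_
    simp only [signVector]
    split_ifs with hi
    · simp [hy i hi]
    · ring
  rw [quad, quad, h1, h2]
  ring

theorem coe_sign_eq {a : ℝ} : ((SignType.sign a : SignType) : ℝ) = Real.sign a := by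
  rcases lt_trichotomy a 0 with h | h | h
  · simp [sign_neg h, Real.sign_of_neg h]
  · simp [h]
  · simp [sign_pos h, Real.sign_of_pos h]

theorem coe_signType_mul_le_abs (σ : SignType) (a : ℝ) : (σ : ℝ) * a ≤ |a| := by
  cases σ
  · simp
  · simpa using neg_le_abs a
  · simpa using le_abs_self a

/-- On the support, `v(x)` is the smooth gradient plus `τ sign(xᵢ)`, the gradient of the model; off
the support the masks make that gradient vanish. -/
theorem norm_restrictSupport_sq {n : ℕ} {A : Matrix (Fin n) (Fin n) ℝ}
    (b : EuclideanSpace ℝ (Fin n)) (τ : ℝ) (x : EuclideanSpace ℝ (Fin n)) :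
    ‖restrictSupport x (explicitSubgradient A b τ x)‖ ^ 2 =
      ‖gradQuad (signMatrix A fun i => SignType.sign (x i))
        (signVector b τ fun i => SignType.sign (x i)) x‖ ^ 2 := by
  rw [EuclideanSpace.norm_sq_eq, EuclideanSpace.norm_sq_eq]
  have hx : ∀ i, SignType.sign (x i) = 0 → x.ofLp i = 0 := fun i h => sign_eq_zero_iff.1 h
  refine Eq.trans (Finset.sum_subtype (p := fun i => x i ≠ 0)
    (Finset.univ.filter fun i => x i ≠ 0) (fun i => by simp)
    (fun i => ‖explicitSubgradient A b τ x i‖ ^ 2)).symm ?_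
  rw [Finset.sum_filter]
  refine Finset.sum_congr rfl fun i _ => ?_
  simp only [gradQuad, signVector, signMatrix_mulVec A hx, explicitSubgradient, sign_eq_zero_iff]
  by_cases hi : x i = 0
  · simp [hi]
  · simp only [hi, coe_sign_eq, ne_eq, not_false_eq_true, if_true, if_false]
    congr 2
    ring

end L1QP

/-! ### The main estimate -/

theorem mainTheorem7 {n : ℕ} (A : Matrix (Fin n) (Fin n) ℝ) (hA : A.PosSemidef)
    (b : EuclideanSpace ℝ (Fin n)) (τ : ℝ) (hτ : 0 ≤ τ)
    (hopt : ∃ z, ∀ y, L1QP.objective A b τ z ≤ L1QP.objective A b τ y)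
    (δ : ℝ) (hδ : 0 ≤ δ) :
    ∃ η : ℝ, 0 < η ∧ ∀ x ∈ L1QP.levelSet (L1QP.objective A b τ) δ,
      IsLeast (L1QP.objective A b τ '' L1QP.zeroSubspace x)
          (L1QP.subspaceOptValue (L1QP.objective A b τ) x) ∧
        L1QP.objective A b τ x - L1QP.subspaceOptValue (L1QP.objective A b τ) x ≤
          η * ‖L1QP.restrictSupport x
                (L1QP.minNormSubgradient (L1QP.objective A b τ) x)‖ ^ 2 := by
  obtain ⟨x₀, hx₀⟩ := hopt
  have hoptValue : L1QP.optValue (L1QP.objective A b τ) = L1QP.objective A b τ x₀ :=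
    IsLeast.csInf_eq ⟨⟨x₀, rfl⟩, by rintro _ ⟨y, rfl⟩; exact hx₀ y⟩
  choose η hη hbound using fun s : Fin n → SignType =>
    L1QP.exists_le_norm_gradQuad_sq (L1QP.posSemidef_signMatrix hA s) (L1QP.signVector b τ s) hδ
  -- The sum of positive constants dominates each of them and serves as a maximum over the sign
  -- patterns.
  refine ⟨∑ s, η s, Finset.sum_pos (fun s _ => hη s) Finset.univ_nonempty, fun x hx => ?_⟩
  obtain ⟨z, hz, hzmin⟩ := L1QP.exists_isMinOn_zeroSubspace hA hx₀ x
  have hleast : IsLeast (L1QP.objective A b τ '' L1QP.zeroSubspace x) (L1QP.objective A b τ z) :=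
    ⟨⟨z, hz, rfl⟩, by rintro _ ⟨y, hy, rfl⟩; exact hzmin y hy⟩
  have hval : L1QP.subspaceOptValue (L1QP.objective A b τ) x = L1QP.objective A b τ z :=
    hleast.csInf_eq
  rw [hval]
  refine ⟨hleast, ?_⟩
  rw [L1QP.minNormSubgradient_objective hA b hτ, L1QP.norm_restrictSupport_sq]
  set s : Fin n → SignType := fun i => SignType.sign (x i)
  have hδx : L1QP.objective A b τ x - L1QP.objective A b τ z ≤ δ := by
    have h : L1QP.objective A b τ x - L1QP.optValue (L1QP.objective A b τ) ≤ δ := hx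
    linarith [hx₀ z]
  have hqx : L1QP.quad (L1QP.signMatrix A s) (L1QP.signVector b τ s) x
      = L1QP.objective A b τ x := by
    rw [L1QP.quad_signMatrix A b τ (fun i hi => sign_eq_zero_iff.1 hi), L1QP.objective]
    simp only [sign_mul_self]
  -- `z` may have other signs than `x`, so the model only bounds `F` from below here, which is the
  -- direction needed.
  have hqz : L1QP.quad (L1QP.signMatrix A s) (L1QP.signVector b τ s) z
      ≤ L1QP.objective A b τ z := by
    rw [L1QP.quad_signMatrix A b τ (fun i hi => hz i (sign_eq_zero_iff.1 hi)), L1QP.objective]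
    gcongr
    exact L1QP.coe_signType_mul_le_abs _ _
  refine (hbound s x z _ hδx (by linarith)).trans ?_
  gcongr
  exact Finset.single_le_sum (fun t _ => (hη t).le) (Finset.mem_univ s)
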